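/- Let $0\le\alpha<1$. There is a constant $C>0$, depending only on $\alpha$, such that the following holds. For every $p\ge 1$ let $G_p$ be a random graph on the vertex set $\{1,\dots,p\}$, let $i=i_p$ be a given node and $\gamma=\gamma_p\ge 0$ an integer. For each graph $G$ that occurs with positive probability let a Gaussian graphical model Markov on $G$ be given, i.e. a Gaussian vector $X$ with density proportional to $\exp(-\tfrac12 x^TJ_Gx+h_G^Tx)$, where $J_G$ is symmetric positive definite, for $k\ne l$ one has $J_G(k,l)=0$ if and only if $kl$ is not an edge of $G$, and $J_G$ is normalized, $J_G(k,k)=1$ for all $k$. Let $R_G=I-J_G$ be the partial correlation matrix, $\overline R_G=[|R_G(k,l)|]$, and $\Sigma_G=J_G^{-1}$ the covariance matrix. Assume that, as $p\to\infty$, 1. the model is $\alpha$-walk-summable asymptotically almost surely: $P[\|\overline R_{G_p}\|\le\alpha]\to 1$, where $\|\cdot\|$ is the spectral norm; 2. the ensemble is locally tree-like: $P[\Gamma^c(i;\gamma,G_p)]=o(1)$, where $\Gamma(i;\gamma,G)$ is the event that the subgraph of $G$ induced on the nodes within distance $\gamma$ of $i$ contains no cycle. Consider loopy belief propagation (LBP)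 with parallel updates, started from uninformative messages: for adjacent $k,l$, $\Delta J^0_{k\to l}=0$ and $$\Delta J^{t+1}_{k\to l}=-J_G(l,k)\Big(J_G(k,k)+\sum_{u\in N(k)\setminus l}\Delta J^{t}_{u\to k}\Big)^{-1}J_G(l,k).$$ Then asymptotically almost surely (with probability tending to $1$ as $p\to\infty$) this iteration is well defined, with positive precisions in the brackets, and converges to a fixed point $(\Delta J_{k\to l})$ with positive bracketed and node precisions, and the LBP variance $\Sigma_{\mathrm{LBP}}(i,i)=\big(J_G(i,i)+\sum_{u\in N(i)}\Delta J_{u\to i}\big)^{-1}$ satisfies $$|\Sigma_G(i,i)-\Sigma_{\mathrm{LBP}}(i,i)|\le C\,\max\big(\alpha^{\gamma},\,P[\Gamma^c(i;\gamma,G_p)]\big).$$ -/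

import Mathlib

open Filter Topology

namespace GaussLBP

noncomputable section

/-- The probability of the event `S` when the graph is drawn from the law `P`. -/
def prob {A : Type*} (P : PMF A) (S : Set A) : ℝ :=
  (P.toOuterMeasure S).toReal

section Model

variable {V : Type*} [Fintype V] [DecidableEq V]

/-- `J` is the potential (information) matrix of a Gaussian graphical model Markov on `G`:
symmetric positive definite, with off-diagonal sparsity pattern given exactly by the edges. -/
structure IsPotentialMatrix (G : SimpleGraph V) (J : Matrix V V ℝ) : Prop where
  posDef : J.PosDef
  sparsity : ∀ i j, i ≠ j → (J i j = 0 ↔ ¬ G.Adj i j)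

/-- The law with density proportional to `exp (-xᵀJx/2 + hᵀx)`: the Gaussian law with mean
`J⁻¹h` and covariance matrix `J⁻¹` (for positive definite `J`). -/
def gaussianModel (J : Matrix V V ℝ) (h : V → ℝ) :
    MeasureTheory.Measure (EuclideanSpace ℝ V) :=
  ProbabilityTheory.multivariateGaussian (WithLp.toLp 2 (J⁻¹.mulVec h)) J⁻¹

/-- The true variance of the variable at node `i`. -/
def trueVariance (J : Matrix V V ℝ) (h : V → ℝ) (i : V) : ℝ :=
  ProbabilityTheory.variance (fun x : EuclideanSpace ℝ V => x i) (gaussianModel J h)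

/-- The partial correlation matrix. -/
def partialCorr (J : Matrix V V ℝ) : Matrix V V ℝ :=
  Matrix.of fun i j => if i = j then 0 else -J i j / √(J i i * J j j)

/-- `α`-walk-summability: the spectral norm of the entrywise absolute value of the partial
correlation matrix is at most `α`. (The requirement `α < 1` is imposed on the number `α`.) -/
def WalkSummable (α : ℝ) (J : Matrix V V ℝ) : Prop :=
  ‖Matrix.toEuclideanCLM (n := V) (𝕜 := ℝ) ((partialCorr J).map fun x => |x|)‖ ≤ α

/-- The subgraph induced on the vertices within graph distance `γ` of `i` has no cycle. -/
def LocallyAcyclic (G : SimpleGraph V) (i : V) (γ : ℕ) : Prop :=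
  (G.induce {v | G.edist i v ≤ (γ : ℕ∞)}).IsAcyclic

open Classical in
/-- The precision at `i` collected by LBP from all neighbours except `j`. Here `m k i` is the
precision parameter of the message from `k` to `i`. -/
def cavityPrecision (G : SimpleGraph V) (J : Matrix V V ℝ) (m : V → V → ℝ) (i j : V) : ℝ :=
  J i i + ∑ k ∈ Finset.univ.filter (fun k => G.Adj i k ∧ k ≠ j), m k i

open Classical in
/-- The precision at `i` collected by LBP from all neighbours; its inverse is the LBP variance. -/
def nodePrecision (G : SimpleGraph V) (J : Matrix V V ℝ) (m : V → V → ℝ) (i : V) : ℝ :=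
  J i i + ∑ k ∈ Finset.univ.filter (fun k => G.Adj i k), m k i

/-- One parallel update of the precision parameters of the messages. This recursion does not
involve the potential vector `h`, which only enters the LBP means. The values `m i j` are
meaningful, and used, only for adjacent `i` and `j`. -/
def lbpUpdate (G : SimpleGraph V) (J : Matrix V V ℝ) (m : V → V → ℝ) : V → V → ℝ :=
  fun i j => -(J j i * (cavityPrecision G J m i j)⁻¹ * J j i)

/-- The precision parameters of the messages after `t` parallel iterations, started from
uninformative messages. -/
def lbpMessages (G : SimpleGraph V) (J : Matrix V V ℝ) : ℕ → V → V → ℝ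
  | 0 => fun _ _ => 0
  | t + 1 => lbpUpdate G J (lbpMessages G J t)

/-- `m` is a (proper) fixed point of LBP: all messages and marginals that it defines are
genuine Gaussians, and the messages are reproduced by the update. -/
structure IsLBPFixedPoint (G : SimpleGraph V) (J : Matrix V V ℝ) (m : V → V → ℝ) : Prop where
  cavity_pos : ∀ i j, G.Adj i j → 0 < cavityPrecision G J m i j
  node_pos : ∀ i, 0 < nodePrecision G J m i
  fixed : ∀ i j, G.Adj i j → lbpUpdate G J m i j = m i j

/-- The LBP iteration is well defined at every step and converges to the fixed point `m`. -/
structure LBPConvergesTo (G : SimpleGraph V) (J : Matrix V V ℝ) (m : V → V → ℝ) : Prop where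
  cavity_pos : ∀ t i j, G.Adj i j → 0 < cavityPrecision G J (lbpMessages G J t) i j
  tendsto : ∀ i j, G.Adj i j → Tendsto (fun t => lbpMessages G J t i j) atTop (𝓝 (m i j))
  isFixedPoint : IsLBPFixedPoint G J m

/-- The variance at node `i` defined by the messages `m`. -/
def lbpVariance (G : SimpleGraph V) (J : Matrix V V ℝ) (m : V → V → ℝ) (i : V) : ℝ :=
  (nodePrecision G J m i)⁻¹

end Model

end

end GaussLBP

namespace GaussLBP

section Contraction

variable {V : Type*} [Fintype V]

lemma norm_toLp_le_of_abs_le {x y : V → ℝ} (h : ∀ k, |x k| ≤ y k) :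
    ‖WithLp.toLp 2 x‖ ≤ ‖WithLp.toLp 2 y‖ := by
  rw [EuclideanSpace.norm_eq, EuclideanSpace.norm_eq]
  refine Real.sqrt_le_sqrt (Finset.sum_le_sum fun k _ => ?_)
  simp only [Real.norm_eq_abs]
  exact pow_le_pow_left₀ (abs_nonneg _) ((h k).trans (le_abs_self _)) 2

lemma abs_apply_le_norm_toLp (x : V → ℝ) (k : V) : |x k| ≤ ‖WithLp.toLp 2 x‖ := by
  simpa using PiLp.norm_apply_le (p := 2) (WithLp.toLp 2 x : EuclideanSpace ℝ V) k

variable {A : Matrix V V ℝ} {α : ℝ}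

/-- A vector dominated by its image under a strict contraction vanishes. -/
lemma eq_zero_of_abs_le_mulVec (hα : α < 1)
    (hA : ∀ x, ‖WithLp.toLp 2 (A.mulVec x)‖ ≤ α * ‖WithLp.toLp 2 x‖) {x : V → ℝ}
    (hx : ∀ k, |x k| ≤ A.mulVec x k) : x = 0 := by
  have h1 := (norm_toLp_le_of_abs_le hx).trans (hA x)
  have h2 : ‖WithLp.toLp 2 x‖ = 0 := by
    nlinarith [norm_nonneg (WithLp.toLp 2 x)]
  simpa using h2

/-- For an entrywise nonnegative strict contraction `A`, the equation `v = A v + b` with `b ≥ 0`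
has a nonnegative solution. -/
lemma exists_nonneg_eq_mulVec_add [DecidableEq V] (hα : α < 1)
    (hA : ∀ x, ‖WithLp.toLp 2 (A.mulVec x)‖ ≤ α * ‖WithLp.toLp 2 x‖)
    (hA0 : ∀ k l, 0 ≤ A k l) {b : V → ℝ} (hb : ∀ k, 0 ≤ b k) :
    ∃ v : V → ℝ, (∀ k, 0 ≤ v k) ∧ (∀ k, v k = A.mulVec v k + b k) ∧
      (1 - α) * ‖WithLp.toLp 2 v‖ ≤ ‖WithLp.toLp 2 b‖ := by
  have hinj : Function.Injective (Matrix.toLin' (1 - A)) := by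
    rw [← LinearMap.ker_eq_bot, LinearMap.ker_eq_bot']
    intro x hx
    have hx' : A.mulVec x = x := by
      rw [Matrix.toLin'_apply, Matrix.sub_mulVec, Matrix.one_mulVec, sub_eq_zero] at hx
      exact hx.symm
    have h1 := hA x
    rw [hx'] at h1
    have h2 : ‖WithLp.toLp 2 x‖ = 0 := by
      nlinarith [norm_nonneg (WithLp.toLp 2 x)]
    simpa using h2
  obtain ⟨v, hv⟩ := LinearMap.injective_iff_surjective.1 hinj b
  have hv' : ∀ k, v k = A.mulVec v k + b k := by
    intro k
    have := congrFun hv k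
    rw [Matrix.toLin'_apply, Matrix.sub_mulVec, Matrix.one_mulVec, Pi.sub_apply] at this
    linarith
  refine ⟨v, ?_, hv', ?_⟩
  · have hneg : (fun k => max (-v k) 0) = 0 := by
      refine eq_zero_of_abs_le_mulVec hα hA fun k => ?_
      have h0 : 0 ≤ A.mulVec (fun k => max (-v k) 0) k :=
        Finset.sum_nonneg fun l _ => mul_nonneg (hA0 k l) (le_max_right _ _)
      have h1 : -A.mulVec v k ≤ A.mulVec (fun k => max (-v k) 0) k := by
        simp only [Matrix.mulVec, dotProduct, ← Finset.sum_neg_distrib]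
        refine Finset.sum_le_sum fun l _ => ?_
        have := mul_le_mul_of_nonneg_left (le_max_left (-v l) 0) (hA0 k l)
        linarith
      rw [abs_of_nonneg (le_max_right _ _)]
      refine max_le ?_ h0
      linarith [hv' k, hb k]
    intro k
    have h1 : max (-v k) 0 = 0 := congrFun hneg k
    linarith [le_max_left (-v k) 0]
  · have h1 : v = A.mulVec v + b := funext hv'
    have h2 : ‖WithLp.toLp 2 v‖ ≤ ‖WithLp.toLp 2 (A.mulVec v)‖ + ‖WithLp.toLp 2 b‖ := by
      conv_lhs => rw [h1, WithLp.toLp_add]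
      exact norm_add_le _ _
    linarith [hA v]

lemma norm_iterate_mulVec_le (hα : 0 ≤ α)
    (hA : ∀ x, ‖WithLp.toLp 2 (A.mulVec x)‖ ≤ α * ‖WithLp.toLp 2 x‖) (x : V → ℝ) (n : ℕ) :
    ‖WithLp.toLp 2 (A.mulVec^[n] x)‖ ≤ α ^ n * ‖WithLp.toLp 2 x‖ := by
  induction n with
  | zero => simp
  | succ n ih =>
    rw [Function.iterate_succ_apply', pow_succ', mul_assoc]
    exact (hA _).trans (mul_le_mul_of_nonneg_left ih hα)

lemma iterate_mulVec_nonneg (hA0 : ∀ k l, 0 ≤ A k l) {x : V → ℝ} (hx : ∀ k, 0 ≤ x k) (n : ℕ)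
    (k : V) : 0 ≤ A.mulVec^[n] x k := by
  induction n generalizing k with
  | zero => exact hx k
  | succ n ih =>
    rw [Function.iterate_succ_apply']
    exact Finset.sum_nonneg fun l _ => mul_nonneg (hA0 k l) (ih l)

end Contraction

section LocalTree

variable {V : Type*} {G : SimpleGraph V} {i : V} {γ : ℕ}

/-- The lower neighbour of a vertex, on a geodesic to `i`. -/
lemma exists_adj_dist_eq {n : ℕ} {k : V} (hk : G.edist i k = ((n + 1 : ℕ) : ℕ∞)) :
    ∃ l, G.Adj k l ∧ G.edist i l = (n : ℕ∞) := by
  rw [SimpleGraph.edist_comm] at hk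
  obtain ⟨p, hp⟩ := SimpleGraph.exists_walk_of_edist_eq_coe hk
  cases p with
  | nil => simp at hp
  | @cons _ l _ h q =>
    refine ⟨l, h, le_antisymm ?_ ?_⟩
    · rw [SimpleGraph.edist_comm]
      refine (SimpleGraph.edist_le q).trans ?_
      simp only [SimpleGraph.Walk.length_cons] at hp
      exact_mod_cast (by omega : q.length ≤ n)
    · have h1 : G.edist k i ≤ G.edist k l + G.edist l i := SimpleGraph.edist_triangle
      rw [hk, SimpleGraph.edist_eq_one_iff_adj.2 h, SimpleGraph.edist_comm (u := l)] at h1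
      push_cast at h1
      rw [add_comm] at h1
      exact (ENat.add_le_add_iff_left (by simp)).1 h1

lemma edist_le_add_one_of_adj {k u : V} (h : G.Adj k u) : G.edist i u ≤ G.edist i k + 1 := by
  have h1 : G.edist i u ≤ G.edist i k + G.edist k u := SimpleGraph.edist_triangle
  rwa [SimpleGraph.edist_eq_one_iff_adj.2 h] at h1

/-- Geodesics to the centre stay inside the ball. -/
lemma exists_isPath_induce_ball {n : ℕ} {k : V} (hk : G.edist i k = (n : ℕ∞))
    (hi : i ∈ {v | G.edist i v ≤ (γ : ℕ∞)}) (hkγ : k ∈ {v | G.edist i v ≤ (γ : ℕ∞)}) :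
    ∃ p : (G.induce {v | G.edist i v ≤ (γ : ℕ∞)}).Walk ⟨k, hkγ⟩ ⟨i, hi⟩,
      p.IsPath ∧ ∀ w ∈ p.support, w.1 = k ∨ G.edist i w.1 < (n : ℕ∞) := by
  induction n generalizing k with
  | zero =>
    have : i = k := by simpa using hk
    subst this
    exact ⟨.nil, by simp, by simp⟩
  | succ n ih =>
    obtain ⟨l, hl, hln⟩ := exists_adj_dist_eq hk
    have hnn : (n : ℕ∞) < ((n + 1 : ℕ) : ℕ∞) := by exact_mod_cast n.lt_succ_self
    have hlγ : l ∈ {v | G.edist i v ≤ (γ : ℕ∞)} := by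
      have h1 : G.edist i k ≤ γ := hkγ
      change G.edist i l ≤ γ
      rw [hln]; rw [hk] at h1
      exact hnn.le.trans h1
    obtain ⟨p, hp, hps⟩ := ih hln hlγ
    have hlt : ∀ w ∈ p.support, G.edist i w.1 < ((n + 1 : ℕ) : ℕ∞) := by
      intro w hw
      rcases hps w hw with h | h
      · rw [h, hln]; exact hnn
      · exact h.trans hnn
    have hadj : (G.induce {v | G.edist i v ≤ (γ : ℕ∞)}).Adj ⟨k, hkγ⟩ ⟨l, hlγ⟩ := hl
    refine ⟨.cons hadj p, ?_, ?_⟩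
    · rw [SimpleGraph.Walk.cons_isPath_iff]
      refine ⟨hp, fun h => ?_⟩
      have := hlt _ h
      rw [hk] at this
      exact lt_irrefl _ this
    · intro w hw
      rw [SimpleGraph.Walk.support_cons, List.mem_cons] at hw
      rcases hw with h | h
      · left; rw [h]
      · right; exact hlt w h

/-- In a locally acyclic graph, a vertex of the ball has at most one neighbour that is not
farther away from the centre. -/
lemma LocallyAcyclic.eq_of_adj_of_edist_le (hG : LocallyAcyclic G i γ) {k l l' : V}
    (hk : G.edist i k ≤ γ) (hl : G.Adj k l) (hl' : G.Adj k l')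
    (hd : G.edist i l ≤ G.edist i k) (hd' : G.edist i l' ≤ G.edist i k) : l = l' := by
  have hi : i ∈ {v | G.edist i v ≤ (γ : ℕ∞)} := by simp
  have key : ∀ u (hu : G.Adj k u), G.edist i u ≤ G.edist i k →
      ∃ (huγ : u ∈ {v | G.edist i v ≤ (γ : ℕ∞)})
        (p : (G.induce {v | G.edist i v ≤ (γ : ℕ∞)}).Walk ⟨u, huγ⟩ ⟨i, hi⟩),
        (SimpleGraph.Walk.cons
          (show (G.induce {v | G.edist i v ≤ (γ : ℕ∞)}).Adj ⟨k, hk⟩ ⟨u, huγ⟩ from hu) p).IsPath := by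
    intro u hu hdu
    have huγ : u ∈ {v | G.edist i v ≤ (γ : ℕ∞)} := hdu.trans hk
    obtain ⟨n, hn⟩ := ENat.ne_top_iff_exists.1
      (ne_top_of_le_ne_top (ENat.natCast_ne_top γ) (show G.edist i u ≤ γ from huγ))
    obtain ⟨p, hp, hps⟩ := exists_isPath_induce_ball hn.symm hi huγ
    refine ⟨huγ, p, ?_⟩
    rw [SimpleGraph.Walk.cons_isPath_iff]
    refine ⟨hp, fun h => ?_⟩
    rcases hps _ h with h | h
    · exact hu.ne h
    · rw [hn] at h; exact absurd h (not_lt.2 hdu)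
  obtain ⟨h1, p, hp⟩ := key l hl hd
  obtain ⟨h2, q, hq⟩ := key l' hl' hd'
  have h3 := congrArg (fun r => r.1.snd.1)
    ((SimpleGraph.IsAcyclic.subsingleton_path hG _ _).elim ⟨_, hp⟩ ⟨_, hq⟩)
  simpa only [SimpleGraph.Walk.snd_cons] using h3

end LocalTree

section Messages

variable {V : Type*} {G : SimpleGraph V} {J : Matrix V V ℝ}

lemma IsPotentialMatrix.symm (hJ : IsPotentialMatrix G J) (k l : V) : J k l = J l k := by
  simpa using hJ.posDef.isHermitian.apply l k

lemma IsPotentialMatrix.ne_zero (hJ : IsPotentialMatrix G J) {k l : V} (h : G.Adj k l) :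
    J k l ≠ 0 :=
  fun h0 => (hJ.sparsity k l h.ne).1 h0 h

variable [DecidableEq V]

/-- The entrywise absolute value of the partial correlation matrix. -/
noncomputable def absPartialCorr (J : Matrix V V ℝ) : Matrix V V ℝ :=
  (partialCorr J).map fun x => |x|

lemma absPartialCorr_nonneg (J : Matrix V V ℝ) (k l : V) : 0 ≤ absPartialCorr J k l :=
  abs_nonneg _

lemma absPartialCorr_self (J : Matrix V V ℝ) (k : V) : absPartialCorr J k k = 0 := by
  simp [absPartialCorr, partialCorr]

lemma absPartialCorr_of_ne (hd : ∀ k, J k k = 1) {k l : V} (h : k ≠ l) :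
    absPartialCorr J k l = |J k l| := by
  simp [absPartialCorr, partialCorr, h, hd]

lemma IsPotentialMatrix.absPartialCorr_of_not_adj (hJ : IsPotentialMatrix G J)
    (hd : ∀ k, J k k = 1) {k l : V} (h : ¬ G.Adj k l) : absPartialCorr J k l = 0 := by
  by_cases hkl : k = l
  · rw [hkl, absPartialCorr_self]
  · rw [absPartialCorr_of_ne hd hkl, (hJ.sparsity k l hkl).2 h, abs_zero]

variable [Fintype V]

lemma WalkSummable.norm_mulVec_le {α : ℝ} (h : WalkSummable α J) (x : V → ℝ) :
    ‖WithLp.toLp 2 ((absPartialCorr J).mulVec x)‖ ≤ α * ‖WithLp.toLp 2 x‖ :=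
  (Matrix.toEuclideanCLM (n := V) (𝕜 := ℝ) (absPartialCorr J)).le_of_opNorm_le h
    (WithLp.toLp 2 x)

open Classical in
lemma IsPotentialMatrix.absPartialCorr_mulVec (hJ : IsPotentialMatrix G J) (hd : ∀ k, J k k = 1)
    (v : V → ℝ) (k : V) :
    (absPartialCorr J).mulVec v k
      = ∑ u ∈ Finset.univ.filter (fun u => G.Adj k u), |J u k| * v u := by
  rw [Finset.sum_filter]
  refine Finset.sum_congr rfl fun u _ => ?_
  change absPartialCorr J k u * v u = _
  split_ifs with h
  · rw [absPartialCorr_of_ne hd h.ne, hJ.symm]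
  · rw [hJ.absPartialCorr_of_not_adj hd h, zero_mul]

open Classical in
lemma IsPotentialMatrix.mulVec_eq (hJ : IsPotentialMatrix G J) (hd : ∀ k, J k k = 1)
    (y : V → ℝ) (k : V) :
    J.mulVec y k = y k + ∑ u ∈ Finset.univ.filter (fun u => G.Adj k u), J k u * y u := by
  have h1 : ∀ u, J k u * y u
      = (if u = k then y k else 0) + (if G.Adj k u then J k u * y u else 0) := by
    intro u
    by_cases huk : u = k
    · subst huk; simp [hd]
    · by_cases h : G.Adj k u
      · simp [huk, h]
      · simp [huk, h, (hJ.sparsity k u (Ne.symm huk)).2 h]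
  rw [Finset.sum_filter]
  change ∑ u, J k u * y u = _
  rw [Finset.sum_congr rfl fun u _ => h1 u, Finset.sum_add_distrib]
  simp

open Classical in
lemma nodePrecision_eq_cavityPrecision_add (m : V → V → ℝ) {k l : V} (h : G.Adj k l) :
    nodePrecision G J m k = cavityPrecision G J m k l + m l k := by
  have h1 : Finset.univ.filter (fun u => G.Adj k u ∧ u ≠ l)
      = (Finset.univ.filter (fun u => G.Adj k u)).erase l := by
    ext u; simp [and_comm]
  rw [nodePrecision, cavityPrecision, h1, add_assoc, Finset.sum_erase_add]
  simpa using h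

/-- The messages `m` are controlled by every nonnegative vector that is superharmonic for the
absolute partial correlation matrix. -/
def MessageBound (G : SimpleGraph V) (J : Matrix V V ℝ) (m : V → V → ℝ) : Prop :=
  ∀ v : V → ℝ, (∀ k, 0 ≤ v k) → (∀ k, (absPartialCorr J).mulVec v k ≤ v k) →
    ∀ u k, G.Adj u k → -(m u k) * v k ≤ |J u k| * v u

variable {m : V → V → ℝ} {v : V → ℝ}

open Classical in
lemma MessageBound.le_nodePrecision_mul (hJ : IsPotentialMatrix G J) (hd : ∀ k, J k k = 1)
    (hm : MessageBound G J m) (hv0 : ∀ k, 0 ≤ v k)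
    (hv : ∀ k, (absPartialCorr J).mulVec v k ≤ v k) (k : V) :
    v k - (absPartialCorr J).mulVec v k ≤ nodePrecision G J m k * v k := by
  rw [hJ.absPartialCorr_mulVec hd, nodePrecision, hd, add_mul, one_mul, sub_eq_add_neg,
    Finset.sum_mul, ← Finset.sum_neg_distrib]
  refine add_le_add_right (Finset.sum_le_sum fun u hu => ?_) _
  have := hm v hv0 hv u k (by simpa using hu : G.Adj k u).symm
  linarith

open Classical in
lemma MessageBound.le_cavityPrecision_mul (hJ : IsPotentialMatrix G J) (hd : ∀ k, J k k = 1)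
    (hm : MessageBound G J m) (hv0 : ∀ k, 0 ≤ v k)
    (hv : ∀ k, (absPartialCorr J).mulVec v k ≤ v k) {k l : V} (h : G.Adj k l) :
    |J k l| * v l ≤ cavityPrecision G J m k l * v k := by
  have h1 : Finset.univ.filter (fun u => G.Adj k u ∧ u ≠ l)
      = (Finset.univ.filter (fun u => G.Adj k u)).erase l := by
    ext u; simp [and_comm]
  have h2 := hv k
  rw [hJ.absPartialCorr_mulVec hd,
    ← Finset.sum_erase_add _ _ (by simpa using h : l ∈ Finset.univ.filter (fun u => G.Adj k u)),
    hJ.symm l k] at h2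
  have h3 : ∑ u ∈ (Finset.univ.filter (fun u => G.Adj k u)).erase l, -(|J u k| * v u)
      ≤ ∑ u ∈ (Finset.univ.filter (fun u => G.Adj k u)).erase l, m u k * v k := by
    refine Finset.sum_le_sum fun u hu => ?_
    have := hm v hv0 hv u k (by simpa using (Finset.mem_erase.1 hu).2 : G.Adj k u).symm
    linarith
  rw [Finset.sum_neg_distrib] at h3
  rw [cavityPrecision, hd, add_mul, one_mul, h1, Finset.sum_mul]
  linarith

lemma MessageBound.cavityPrecision_pos (hJ : IsPotentialMatrix G J) (hd : ∀ k, J k k = 1)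
    (hm : MessageBound G J m) (hv0 : ∀ k, 0 < v k)
    (hv : ∀ k, (absPartialCorr J).mulVec v k ≤ v k) {k l : V} (h : G.Adj k l) :
    0 < cavityPrecision G J m k l := by
  have h1 := hm.le_cavityPrecision_mul hJ hd (fun k => (hv0 k).le) hv h
  have h2 : 0 < |J k l| * v l := mul_pos (abs_pos.2 (hJ.ne_zero h)) (hv0 l)
  exact pos_of_mul_pos_left (h2.trans_le h1) (hv0 k).le

lemma MessageBound.lbpUpdate (hJ : IsPotentialMatrix G J) (hd : ∀ k, J k k = 1)
    (hm : MessageBound G J m) (hpos : ∀ k l, G.Adj k l → 0 < cavityPrecision G J m k l) :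
    MessageBound G J (lbpUpdate G J m) := by
  intro v hv0 hv k l h
  have h1 := hm.le_cavityPrecision_mul hJ hd hv0 hv h
  have hc := hpos k l h
  rw [GaussLBP.lbpUpdate, neg_neg, hJ.symm l k]
  calc J k l * (cavityPrecision G J m k l)⁻¹ * J k l * v l
      = |J k l| * (cavityPrecision G J m k l)⁻¹ * (|J k l| * v l) := by
        have := abs_mul_abs_self (J k l)
        linear_combination (-(cavityPrecision G J m k l)⁻¹ * v l) * this
    _ ≤ |J k l| * (cavityPrecision G J m k l)⁻¹ * (cavityPrecision G J m k l * v k) := by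
        gcongr
    _ = |J k l| * v k := by field_simp

lemma messageBound_lbpMessages (hJ : IsPotentialMatrix G J) (hd : ∀ k, J k k = 1)
    (hv0 : ∀ k, 0 < v k) (hv : ∀ k, (absPartialCorr J).mulVec v k ≤ v k) (t : ℕ) :
    MessageBound G J (lbpMessages G J t) := by
  induction t with
  | zero =>
    intro v hv0 _ u k _
    simpa [lbpMessages] using mul_nonneg (abs_nonneg (J u k)) (hv0 u)
  | succ t ih => exact ih.lbpUpdate hJ hd fun k l h => ih.cavityPrecision_pos hJ hd hv0 hv h

lemma lbpMessages_succ_le (hJ : IsPotentialMatrix G J) (hd : ∀ k, J k k = 1)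
    (hv0 : ∀ k, 0 < v k) (hv : ∀ k, (absPartialCorr J).mulVec v k ≤ v k) (t : ℕ) {k l : V}
    (h : G.Adj k l) : lbpMessages G J (t + 1) k l ≤ lbpMessages G J t k l := by
  have hpos := fun t {k l} (h : G.Adj k l) =>
    (messageBound_lbpMessages hJ hd hv0 hv t).cavityPrecision_pos hJ hd hv0 hv h
  induction t generalizing k l with
  | zero =>
    have := mul_nonneg (inv_nonneg.2 (hpos 0 h).le) (mul_self_nonneg (J l k))
    simp only [lbpMessages, lbpUpdate] at this ⊢
    linarith
  | succ t ih =>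
    have h1 : cavityPrecision G J (lbpMessages G J (t + 1)) k l
        ≤ cavityPrecision G J (lbpMessages G J t) k l := by
      refine add_le_add_right (Finset.sum_le_sum fun u hu => ih ?_) _
      simp only [Finset.mem_filter] at hu
      exact hu.2.1.symm
    have h2 := inv_anti₀ (hpos (t + 1) h) h1
    have h3 := mul_le_mul_of_nonneg_left h2 (mul_self_nonneg (J l k))
    change -(J l k * (cavityPrecision G J (lbpMessages G J (t + 1)) k l)⁻¹ * J l k)
      ≤ -(J l k * (cavityPrecision G J (lbpMessages G J t) k l)⁻¹ * J l k)
    linarith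

/-- A strictly positive strictly superharmonic vector forces parallel LBP to converge. -/
theorem exists_lbpConvergesTo (hJ : IsPotentialMatrix G J) (hd : ∀ k, J k k = 1)
    (hv0 : ∀ k, 0 < v k) (hv : ∀ k, (absPartialCorr J).mulVec v k < v k) :
    ∃ m, LBPConvergesTo G J m ∧ MessageBound G J m := by
  have hv' := fun k => (hv k).le
  have hb := messageBound_lbpMessages hJ hd hv0 hv'
  set m : V → V → ℝ := fun k l => ⨅ t, lbpMessages G J t k l with hm
  have hlim : ∀ k l, G.Adj k l →
      Tendsto (fun t => lbpMessages G J t k l) atTop (𝓝 (m k l)) := by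
    intro k l h
    refine tendsto_atTop_ciInf
      (antitone_nat_of_succ_le fun t => lbpMessages_succ_le hJ hd hv0 hv' t h) ?_
    refine ⟨-(|J k l| * v k / v l), ?_⟩
    rintro _ ⟨t, rfl⟩
    have h1 := hb t v (fun k => (hv0 k).le) hv' k l h
    rw [← le_div_iff₀ (hv0 l)] at h1
    linarith
  have hmb : MessageBound G J m := by
    intro w hw0 hw k l h
    exact le_of_tendsto ((hlim k l h).neg.mul_const _)
      (Eventually.of_forall fun t => hb t w hw0 hw k l h)
  have hcav : ∀ k l, G.Adj k l → 0 < cavityPrecision G J m k l :=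
    fun k l h => hmb.cavityPrecision_pos hJ hd hv0 hv' h
  refine ⟨m, ⟨fun t k l h => (hb t).cavityPrecision_pos hJ hd hv0 hv' h, hlim, hcav, ?_, ?_⟩, hmb⟩
  · intro k
    have h1 := hmb.le_nodePrecision_mul hJ hd (fun k => (hv0 k).le) hv' k
    exact pos_of_mul_pos_left ((sub_pos.2 (hv k)).trans_le h1) (hv0 k).le
  · intro k l h
    have h1 : Tendsto (fun t => cavityPrecision G J (lbpMessages G J t) k l) atTop
        (𝓝 (cavityPrecision G J m k l)) := by
      refine tendsto_const_nhds.add (tendsto_finsetSum _ fun u hu => hlim u k ?_)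
      simp only [Finset.mem_filter] at hu
      exact hu.2.1.symm
    have h2 : Tendsto (fun t => lbpMessages G J (t + 1) k l) atTop
        (𝓝 (GaussLBP.lbpUpdate G J m k l)) :=
      (((h1.inv₀ (hcav k l h).ne').const_mul _).mul_const _).neg
    exact tendsto_nhds_unique h2 ((tendsto_add_atTop_iff_nat 1).2 (hlim k l h))

end Messages

section Accuracy

variable {V : Type*} {G : SimpleGraph V} {J : Matrix V V ℝ}

open Classical in
/-- In a locally acyclic graph, values can be propagated from the centre of the ball outwards
along edges. -/
lemma LocallyAcyclic.exists_propagate {i : V} {γ : ℕ} (hG : LocallyAcyclic G i γ) (a : ℝ)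
    (w : V → V → ℝ) :
    ∃ y : V → ℝ, y i = a ∧ (∀ k, ¬ G.edist i k ≤ γ → y k = 0) ∧
      ∀ k l, G.edist i k ≤ γ → G.Adj k l → G.edist i l < G.edist i k → y k = w k l * y l := by
  set par : V → V := fun k =>
    if h : ∃ l, G.Adj k l ∧ G.edist i l < G.edist i k then h.choose else k with hpar
  set Y : ℕ → V → ℝ := fun n => Nat.rec (fun _ => a) (fun _ f k => w k (par k) * f (par k)) n
    with hY
  refine ⟨fun k => if G.edist i k ≤ γ then Y (G.edist i k).toNat k else 0, ?_, ?_, ?_⟩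
  · simp [hY]
  · intro k hk
    simp [hk]
  · intro k l hk h hlt
    have hex : ∃ l, G.Adj k l ∧ G.edist i l < G.edist i k := ⟨l, h, hlt⟩
    have hpl : par k = l := by
      have h1 : par k = hex.choose := by simp only [hpar, dif_pos hex]
      rw [h1]
      exact hG.eq_of_adj_of_edist_le hk hex.choose_spec.1 h hex.choose_spec.2.le hlt.le
    have hl : G.edist i l ≤ γ := hlt.le.trans hk
    obtain ⟨n, hn⟩ := ENat.ne_top_iff_exists.1 (ne_top_of_le_ne_top (ENat.natCast_ne_top γ) hl)
    have hkn : G.edist i k = ((n + 1 : ℕ) : ℕ∞) := by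
      refine le_antisymm ?_ ?_
      · have := edist_le_add_one_of_adj (i := i) h.symm
        rw [← hn] at this
        exact_mod_cast this
      · rw [← hn] at hlt
        push_cast
        exact Order.add_one_le_of_lt hlt
    simp only [if_pos hk, if_pos hl]
    rw [hkn, ← hn, ENat.toNat_natCast, ENat.toNat_natCast]
    change w k (par k) * Y n (par k) = _
    rw [hpl]

variable [DecidableEq V] [Fintype V]

/-- The Green vector of `i` is carried, at distance at least `n`, by its `n`-th image. -/
lemma IsPotentialMatrix.eq_iterate_mulVec_of_le_edist (hJ : IsPotentialMatrix G J)
    (hd : ∀ k, J k k = 1) {i : V} {v : V → ℝ}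
    (hv : ∀ k, v k = (absPartialCorr J).mulVec v k + (Pi.single i 1 : V → ℝ) k) (n : ℕ) {k : V}
    (hk : (n : ℕ∞) ≤ G.edist i k) : v k = (absPartialCorr J).mulVec^[n] v k := by
  induction n generalizing k with
  | zero => rfl
  | succ n ih =>
    have hki : k ≠ i := by
      rintro rfl
      simp at hk
    rw [Function.iterate_succ_apply', hv k, Pi.single_eq_of_ne hki, add_zero]
    refine Finset.sum_congr rfl fun u _ => ?_
    change absPartialCorr J k u * v u = absPartialCorr J k u * _
    by_cases h : G.Adj k u
    · rw [← ih]
      have h1 := hk.trans (edist_le_add_one_of_adj (i := i) h.symm)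
      push_cast at h1
      exact (ENat.add_le_add_iff_right (by simp)).1 h1
    · rw [hJ.absPartialCorr_of_not_adj hd h, zero_mul, zero_mul]

open Classical in
/-- Messages that are fixed by LBP solve the linear system of the covariance in the interior of
an acyclic ball. -/
lemma IsLBPFixedPoint.mulVec_eq_single {m : V → V → ℝ} (hm : IsLBPFixedPoint G J m)
    (hJ : IsPotentialMatrix G J) (hd : ∀ k, J k k = 1) {i : V} {γ : ℕ}
    (hG : LocallyAcyclic G i γ) {y : V → ℝ} (hyi : y i = (nodePrecision G J m i)⁻¹)
    (hy : ∀ k l, G.edist i k ≤ γ → G.Adj k l → G.edist i l < G.edist i k →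
      y k = -J k l / cavityPrecision G J m k l * y l) {k : V} (hk : G.edist i k < γ) :
    J.mulVec y k = (Pi.single i 1 : V → ℝ) k := by
  have hchild : ∀ u, G.Adj k u → G.edist i k < G.edist i u → J k u * y u = m u k * y k := by
    intro u h hlt
    have hu : G.edist i u ≤ γ :=
      (edist_le_add_one_of_adj h).trans (Order.add_one_le_of_lt hk)
    rw [hy u k hu h.symm hlt, ← hm.fixed u k h.symm, lbpUpdate, hJ.symm u k]
    ring
  have hnode : nodePrecision G J m k * y k
      = y k + ∑ u ∈ Finset.univ.filter (fun u => G.Adj k u), m u k * y k := by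
    rw [nodePrecision, hd, add_mul, one_mul, Finset.sum_mul]
  rw [hJ.mulVec_eq hd]
  by_cases hki : k = i
  · subst hki
    rw [Pi.single_eq_same, ← mul_inv_cancel₀ (hm.node_pos k).ne', ← hyi, hnode]
    congr 1
    refine Finset.sum_congr rfl fun u hu => ?_
    have h : G.Adj k u := by simpa using hu
    refine hchild u h ?_
    rw [SimpleGraph.edist_self]
    exact SimpleGraph.edist_pos_of_ne h.ne
  · rw [Pi.single_eq_of_ne hki]
    obtain ⟨n, hn⟩ := ENat.ne_top_iff_exists.1 hk.ne_top
    obtain ⟨l, hl, hln⟩ : ∃ l, G.Adj k l ∧ G.edist i l < G.edist i k := by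
      cases n with
      | zero => exact absurd (SimpleGraph.edist_eq_zero_iff.1 hn.symm).symm hki
      | succ n =>
        obtain ⟨l, hl, hln⟩ := exists_adj_dist_eq hn.symm
        refine ⟨l, hl, ?_⟩
        rw [hln, ← hn]
        exact_mod_cast n.lt_succ_self
    have hmem : l ∈ Finset.univ.filter (fun u => G.Adj k u) := by simpa using hl
    have hrest : ∑ u ∈ (Finset.univ.filter (fun u => G.Adj k u)).erase l, J k u * y u
        = ∑ u ∈ (Finset.univ.filter (fun u => G.Adj k u)).erase l, m u k * y k := by
      refine Finset.sum_congr rfl fun u hu => ?_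
      obtain ⟨hul, hu⟩ := Finset.mem_erase.1 hu
      have h : G.Adj k u := by simpa using hu
      refine hchild u h (not_le.1 fun hle => hul ?_)
      exact hG.eq_of_adj_of_edist_le hk.le h hl hle hln.le
    rw [← Finset.sum_erase_add _ _ hmem] at hnode ⊢
    rw [hrest]
    rw [nodePrecision_eq_cavityPrecision_add m hl, add_mul] at hnode
    have hyk : cavityPrecision G J m k l * y k = -J k l * y l := by
      rw [hy k l hk.le hl hln, ← mul_assoc, mul_div_cancel₀ _ (hm.cavity_pos k l hl).ne']
    linarith

lemma MessageBound.abs_propagate_le {m : V → V → ℝ} (hmb : MessageBound G J m)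
    (hm : IsLBPFixedPoint G J m) (hJ : IsPotentialMatrix G J) (hd : ∀ k, J k k = 1) {i : V}
    {γ : ℕ} {y v : V → ℝ} (hyi : y i = (nodePrecision G J m i)⁻¹)
    (hy0 : ∀ k, ¬ G.edist i k ≤ γ → y k = 0)
    (hy : ∀ k l, G.edist i k ≤ γ → G.Adj k l → G.edist i l < G.edist i k →
      y k = -J k l / cavityPrecision G J m k l * y l)
    (hv0 : ∀ k, 0 ≤ v k)
    (hv : ∀ k, v k = (absPartialCorr J).mulVec v k + (Pi.single i 1 : V → ℝ) k) (k : V) :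
    |y k| ≤ v k := by
  have hv' : ∀ k, (absPartialCorr J).mulVec v k ≤ v k := by
    intro k
    have h1 : 0 ≤ (Pi.single i 1 : V → ℝ) k := by
      by_cases h : k = i
      · subst h; simp
      · simp [h]
    linarith [hv k]
  by_cases hk : G.edist i k ≤ γ
  swap
  · rw [hy0 k hk, abs_zero]
    exact hv0 k
  obtain ⟨n, hn⟩ := ENat.ne_top_iff_exists.1 (ne_top_of_le_ne_top (ENat.natCast_ne_top γ) hk)
  induction n generalizing k with
  | zero =>
    obtain rfl : i = k := SimpleGraph.edist_eq_zero_iff.1 hn.symm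
    have h1 := hmb.le_nodePrecision_mul hJ hd hv0 hv' i
    have h2 := hv i
    rw [Pi.single_eq_same] at h2
    rw [hyi, abs_of_pos (inv_pos.2 (hm.node_pos i)), inv_le_iff_one_le_mul₀' (hm.node_pos i)]
    linarith
  | succ n ih =>
    obtain ⟨l, hl, hln⟩ := exists_adj_dist_eq hn.symm
    have hlt : G.edist i l < G.edist i k := by
      rw [hln, ← hn]
      exact_mod_cast n.lt_succ_self
    have hc := hm.cavity_pos k l hl
    rw [hy k l hk hl hlt, abs_mul, abs_div, abs_neg, abs_of_pos hc, div_mul_eq_mul_div,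
      div_le_iff₀ hc]
    calc |J k l| * |y l| ≤ |J k l| * v l := by
          gcongr
          exact ih l (hlt.le.trans hk) hln.symm
      _ ≤ cavityPrecision G J m k l * v k := hmb.le_cavityPrecision_mul hJ hd hv0 hv' hl
      _ = v k * cavityPrecision G J m k l := mul_comm _ _

lemma IsPotentialMatrix.trueVariance_eq (hJ : IsPotentialMatrix G J) (h : V → ℝ) (i : V) :
    trueVariance J h i = J⁻¹ i i :=
  ProbabilityTheory.variance_eval_multivariateGaussian hJ.posDef.inv.posSemidef i

lemma norm_toLp_single_one (i : V) : ‖WithLp.toLp 2 (Pi.single i 1 : V → ℝ)‖ = 1 := by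
  simp

/-- A residual bound for linear systems with a walk-summable potential matrix. -/
lemma IsPotentialMatrix.norm_le_of_mulVec (hJ : IsPotentialMatrix G J) (hd : ∀ k, J k k = 1)
    {α : ℝ} (hW : WalkSummable α J) (x : V → ℝ) :
    (1 - α) * ‖WithLp.toLp 2 x‖ ≤ ‖WithLp.toLp 2 (J.mulVec x)‖ := by
  classical
  have h1 : ∀ k, |x k| ≤ ((absPartialCorr J).mulVec (fun l => |x l|)
      + fun l => |J.mulVec x l|) k := by
    intro k
    have h2 : x k = J.mulVec x k
        - ∑ u ∈ Finset.univ.filter (fun u => G.Adj k u), J k u * x u := by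
      rw [hJ.mulVec_eq hd]; ring
    rw [Pi.add_apply, hJ.absPartialCorr_mulVec hd]
    calc |x k| ≤ |J.mulVec x k|
          + |∑ u ∈ Finset.univ.filter (fun u => G.Adj k u), J k u * x u| := by
          conv_lhs => rw [h2]
          exact abs_sub _ _
      _ ≤ |J.mulVec x k| + ∑ u ∈ Finset.univ.filter (fun u => G.Adj k u), |J u k| * |x u| := by
          gcongr
          refine (Finset.abs_sum_le_sum_abs _ _).trans (Finset.sum_le_sum fun u _ => ?_)
          rw [abs_mul, hJ.symm k u]
      _ = _ := add_comm _ _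
  have habs : ∀ z : V → ℝ, ‖WithLp.toLp 2 (fun l => |z l|)‖ ≤ ‖WithLp.toLp 2 z‖ := by
    intro z
    simp [EuclideanSpace.norm_eq]
  have h2 := norm_toLp_le_of_abs_le h1
  rw [WithLp.toLp_add] at h2
  have h3 := h2.trans (norm_add_le _ _)
  have h4 := hW.norm_mulVec_le (fun l => |x l|)
  have h5 : ‖WithLp.toLp 2 x‖ = ‖WithLp.toLp 2 (fun l => |x l|)‖ := by
    simp [EuclideanSpace.norm_eq]
  have h6 := habs (J.mulVec x)
  rw [← h5] at h4
  linarith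

/-- On a walk-summable model, parallel LBP converges, and its variance at the centre of an acyclic
ball is exponentially accurate in the radius. -/
theorem exists_lbpConvergesTo_and_abs_sub_le (hJ : IsPotentialMatrix G J) (hd : ∀ k, J k k = 1)
    {α : ℝ} (hα0 : 0 ≤ α) (hα1 : α < 1) (hW : WalkSummable α J) {i : V} {γ : ℕ}
    (hG : LocallyAcyclic G i γ) (h : V → ℝ) :
    ∃ m, LBPConvergesTo G J m ∧
      |trueVariance J h i - lbpVariance G J m i| ≤ 2 / (1 - α) ^ 2 * α ^ γ := by
  have hA := hW.norm_mulVec_le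
  have hA0 := absPartialCorr_nonneg J
  have hα : 0 < 1 - α := by linarith
  obtain ⟨w, hw0, hw, -⟩ := exists_nonneg_eq_mulVec_add hα1 hA hA0 (b := fun _ => 1) (by simp)
  have hAw : ∀ k, 0 ≤ (absPartialCorr J).mulVec w k := fun k =>
    Finset.sum_nonneg fun l _ => mul_nonneg (hA0 k l) (hw0 l)
  obtain ⟨m, hm, hmb⟩ := exists_lbpConvergesTo hJ hd (v := w)
    (fun k => by linarith [hw k, hAw k]) (fun k => by linarith [hw k])
  refine ⟨m, hm, ?_⟩
  have hsingle : ∀ k, 0 ≤ (Pi.single i 1 : V → ℝ) k := by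
    intro k
    by_cases hk : k = i
    · subst hk; simp
    · simp [hk]
  obtain ⟨v, hv0, hv, hvn⟩ := exists_nonneg_eq_mulVec_add hα1 hA hA0 hsingle
  rw [norm_toLp_single_one] at hvn
  obtain ⟨y, hyi, hy0, hy⟩ := hG.exists_propagate (nodePrecision G J m i)⁻¹
    fun k l => -J k l / cavityPrecision G J m k l
  have hyv := hmb.abs_propagate_le hm.isFixedPoint hJ hd hyi hy0 hy hv0 hv
  have hres : ∀ k, |(J.mulVec y - (Pi.single i 1 : V → ℝ)) k|
      ≤ ((2 : ℝ) • (absPartialCorr J).mulVec^[γ] v) k := by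
    intro k
    rw [Pi.sub_apply, Pi.smul_apply, smul_eq_mul]
    by_cases hk : G.edist i k < γ
    · rw [hm.isFixedPoint.mulVec_eq_single hJ hd hG hyi hy hk, sub_self, abs_zero]
      exact mul_nonneg zero_le_two (iterate_mulVec_nonneg hA0 hv0 γ k)
    · rw [← hJ.eq_iterate_mulVec_of_le_edist hd hv γ (not_lt.1 hk)]
      classical
      have h1 : |∑ u ∈ Finset.univ.filter (fun u => G.Adj k u), J k u * y u|
          ≤ (absPartialCorr J).mulVec v k := by
        rw [hJ.absPartialCorr_mulVec hd]
        refine (Finset.abs_sum_le_sum_abs _ _).trans (Finset.sum_le_sum fun u _ => ?_)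
        rw [abs_mul, hJ.symm k u]
        exact mul_le_mul_of_nonneg_left (hyv u) (abs_nonneg _)
      rw [hJ.mulVec_eq hd]
      have h2 := abs_le.1 h1
      have h3 := abs_le.1 (hyv k)
      have h4 := hsingle k
      have h5 := hv k
      have h6 := hv0 k
      rw [abs_le]
      constructor <;> linarith [h2.1, h2.2, h3.1, h3.2]
  have hn : ‖WithLp.toLp 2 (J.mulVec y - Pi.single i 1)‖ ≤ 2 * (α ^ γ * ‖WithLp.toLp 2 v‖) := by
    refine (norm_toLp_le_of_abs_le hres).trans ?_
    rw [WithLp.toLp_smul, norm_smul, Real.norm_two]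
    exact mul_le_mul_of_nonneg_left (norm_iterate_mulVec_le hα0 hA v γ) zero_le_two
  have hdet : IsUnit J.det := (Matrix.isUnit_iff_isUnit_det J).1 hJ.posDef.isUnit
  have hD : J.mulVec (y - J⁻¹.mulVec (Pi.single i 1)) = J.mulVec y - Pi.single i 1 := by
    rw [Matrix.mulVec_sub, Matrix.mulVec_mulVec, Matrix.mul_nonsing_inv J hdet, Matrix.one_mulVec]
  have hs := hJ.norm_le_of_mulVec hd hW (y - J⁻¹.mulVec (Pi.single i 1))
  rw [hD] at hs
  have hi := abs_apply_le_norm_toLp (y - J⁻¹.mulVec (Pi.single i 1)) i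
  have hsi : J⁻¹.mulVec (Pi.single i 1) i = J⁻¹ i i := by
    rw [Matrix.mulVec_single_one, Matrix.col_apply]
  rw [Pi.sub_apply, hsi, hyi, abs_sub_comm] at hi
  rw [hJ.trueVariance_eq, lbpVariance, div_mul_eq_mul_div, le_div_iff₀ (pow_pos hα 2)]
  calc _ ≤ ‖WithLp.toLp 2 (y - J⁻¹.mulVec (Pi.single i 1))‖ * (1 - α) ^ 2 := by gcongr
    _ = (1 - α) * ((1 - α) * ‖WithLp.toLp 2 (y - J⁻¹.mulVec (Pi.single i 1))‖) := by ring
    _ ≤ (1 - α) * (2 * (α ^ γ * ‖WithLp.toLp 2 v‖)) := mul_le_mul_of_nonneg_left (hs.trans hn) hα.le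
    _ = 2 * α ^ γ * ((1 - α) * ‖WithLp.toLp 2 v‖) := by ring
    _ ≤ 2 * α ^ γ * 1 := by gcongr
    _ = 2 * α ^ γ := mul_one _

end Accuracy

section Probability

variable {A : Type*} (P : PMF A)

lemma prob_le_one (S : Set A) : prob P S ≤ 1 := by
  refine ENNReal.toReal_le_of_le_ofReal zero_le_one ?_
  rw [ENNReal.ofReal_one, ← (P.toOuterMeasure_apply_eq_one_iff Set.univ).2 (Set.subset_univ _)]
  exact P.toOuterMeasure.mono (Set.subset_univ S)

lemma toOuterMeasure_ne_top (S : Set A) : P.toOuterMeasure S ≠ ⊤ := by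
  refine ne_top_of_le_ne_top ENNReal.one_ne_top ?_
  rw [← (P.toOuterMeasure_apply_eq_one_iff Set.univ).2 (Set.subset_univ _)]
  exact P.toOuterMeasure.mono (Set.subset_univ S)

lemma prob_sub_prob_le {S T U : Set A} (h : ∀ a ∈ P.support, a ∈ S → a ∉ T → a ∈ U) :
    prob P S - prob P T ≤ prob P U := by
  have h1 : P.toOuterMeasure S ≤ P.toOuterMeasure U + P.toOuterMeasure T := by
    refine (P.toOuterMeasure_mono (t := U ∪ T) ?_).trans
      (MeasureTheory.measure_union_le U T)
    rintro a ⟨haS, haP⟩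
    by_cases haT : a ∈ T
    · exact Or.inr haT
    · exact Or.inl (h a haP haS haT)
  have h2 := ENNReal.toReal_mono
    (ENNReal.add_ne_top.2 ⟨toOuterMeasure_ne_top P U, toOuterMeasure_ne_top P T⟩) h1
  rw [ENNReal.toReal_add (toOuterMeasure_ne_top P U) (toOuterMeasure_ne_top P T)] at h2
  exact sub_le_iff_le_add.2 h2

end Probability

end GaussLBP

theorem proposition2 (α : ℝ) (hα0 : 0 ≤ α) (hα1 : α < 1) :
    ∃ C : ℝ, 0 < C ∧
      ∀ (P : ∀ p : ℕ+, PMF (SimpleGraph (Fin (p : ℕ))))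
        (J : ∀ p : ℕ+, SimpleGraph (Fin (p : ℕ)) → Matrix (Fin (p : ℕ)) (Fin (p : ℕ)) ℝ)
        (h : ∀ p : ℕ+, SimpleGraph (Fin (p : ℕ)) → Fin (p : ℕ) → ℝ)
        (i : ∀ p : ℕ+, Fin (p : ℕ)) (γ : ℕ+ → ℕ),
        (∀ p, ∀ G ∈ (P p).support, GaussLBP.IsPotentialMatrix G (J p G)) →
        (∀ p, ∀ G ∈ (P p).support, ∀ k, J p G k k = 1) →
        Tendsto (fun p => GaussLBP.prob (P p) {G | GaussLBP.WalkSummable α (J p G)})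
          atTop (𝓝 1) →
        Tendsto (fun p => GaussLBP.prob (P p) {G | ¬ GaussLBP.LocallyAcyclic G (i p) (γ p)})
          atTop (𝓝 0) →
        Tendsto (fun p => GaussLBP.prob (P p)
            {G | ∃ m, GaussLBP.LBPConvergesTo G (J p G) m ∧
              |GaussLBP.trueVariance (J p G) (h p G) (i p)
                  - GaussLBP.lbpVariance G (J p G) m (i p)|
                ≤ C * max (α ^ γ p)
                    (GaussLBP.prob (P p) {G' | ¬ GaussLBP.LocallyAcyclic G' (i p) (γ p)})})
          atTop (𝓝 1) := by
  have hα : 0 < 1 - α := by linarith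
  refine ⟨2 / (1 - α) ^ 2, by positivity, fun P J h i γ hJ hd hW hG => ?_⟩
  have hlow := hW.sub hG
  rw [sub_zero] at hlow
  refine tendsto_of_tendsto_of_tendsto_of_le_of_le hlow tendsto_const_nhds (fun p => ?_)
    fun p => GaussLBP.prob_le_one _ _
  refine GaussLBP.prob_sub_prob_le (P p) fun G hGP hGW hGA => ?_
  obtain ⟨m, hm, hle⟩ := GaussLBP.exists_lbpConvergesTo_and_abs_sub_le (hJ p G hGP) (hd p G hGP)
    hα0 hα1 hGW (not_not.1 hGA) (h p G)
  exact ⟨m, hm, hle.trans (by gcongr; exact le_max_left _ _)⟩
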